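/- Let $\delta\in(0,1)$ and $C>0$. There exists a function $F:\mathbb{R}\to\mathbb{R}$ which is $C^\infty$, even, nonnegative and supported in $[-1,1]$, and whose Fourier transform $\widehat F(k)=\int_{\mathbb{R}} e^{-2\pi i k x}F(x)\,dx$ is real-valued on $\mathbb{R}$, is monotone decreasing (that is, non-increasing) on $[0,\infty)$, and has the following property: for every $\epsilon>0$ there are constants $c_1,c_2>0$ (which may depend on $\epsilon$, $\delta$, $C$ and $F$) such that for all $k\ge 0$ $$e^{-(1+\epsilon)Ck^\delta}\le c_1\,\widehat F(k)\qquad\text{and}\qquad \widehat F(k)\le c_2\,e^{-(1-\epsilon)Ck^\delta}.$$ The same function $F$ works for all $\epsilon>0$. -/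

import Mathlib

open scoped FourierTransform ContDiff

open MeasureTheory Set Filter Topology

/-! Build `F` from its transform, an infinite product `P k = ∏ φ̂ (a i * k)` with `φ = tentSq`. The
squared tent is chosen because `φ̂` is `6 (w - sin w) / w ^ 3` with `w = 2πk`, which is positive and
decreasing on `[0, ∞)`, and `P` inherits both properties. (The plain tent gives `sinc ^ 2`, which is
not monotone.) On the space side `F` is a limit of convolutions of rescaled copies of `φ`, hence
nonnegative and supported in `[-∑ a i, ∑ a i]`.

With `a i = ((N + 2 + i) / m) ^ (-1/δ)` and `g u = -log φ̂ (u ^ (-1/δ))`, the quantity `-log P k` is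
the sum of `g` over points of spacing `1 / (m k ^ δ)`: a Riemann sum, close to `m k ^ δ ∫ g`. Taking
`m = C / ∫ g` yields `C k ^ δ`. Since `g` decreases, the sum never exceeds this; the ε-loss on the
other side pays for the omitted initial points. As `1/δ > 1`, the scales are summable, and a large
`N` makes their sum at most 1. The decay of `P` makes `F` smooth. -/

/-! ### Cosine transforms of real functions -/

/-- The cosine transform of a real function on the line. -/
noncomputable def cosTransform (f : ℝ → ℝ) (k : ℝ) : ℝ :=
  ∫ x, f x * Real.cos (2 * Real.pi * (x * k))

theorem integrable_mul_cos {f : ℝ → ℝ} (hf : Integrable f) (k : ℝ) :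
    Integrable fun x => f x * Real.cos (2 * Real.pi * (x * k)) :=
  hf.mul_bdd (c := 1) (Continuous.aestronglyMeasurable (by fun_prop))
    (Eventually.of_forall fun x => by simpa using Real.abs_cos_le_one _)

theorem integrable_mul_sin {f : ℝ → ℝ} (hf : Integrable f) (k : ℝ) :
    Integrable fun x => f x * Real.sin (2 * Real.pi * (x * k)) :=
  hf.mul_bdd (c := 1) (Continuous.aestronglyMeasurable (by fun_prop))
    (Eventually.of_forall fun x => by simpa using Real.abs_sin_le_one _)

theorem fourier_ofReal_eq_cosTransform {f : ℝ → ℝ} (he : Function.Even f) (hf : Integrable f)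
    (k : ℝ) : 𝓕 (fun x : ℝ => (f x : ℂ)) k = (cosTransform f k : ℂ) := by
  have hodd : ∫ x, f x * Real.sin (2 * Real.pi * (x * k)) = 0 := by
    have h := integral_neg_eq_self (fun x => f x * Real.sin (2 * Real.pi * (x * k))) volume
    simp only [he _, neg_mul, mul_neg, Real.sin_neg, integral_neg] at h
    linarith
  rw [Real.fourier_real_eq_integral_exp_smul]
  have h1 : ∀ x : ℝ, Complex.exp (↑(-2 * Real.pi * x * k) * Complex.I) • (f x : ℂ) =
      ((f x * Real.cos (2 * Real.pi * (x * k)) : ℝ) : ℂ) -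
        ((f x * Real.sin (2 * Real.pi * (x * k)) : ℝ) : ℂ) * Complex.I := by
    intro x
    rw [Complex.exp_mul_I, ← Complex.ofReal_cos, ← Complex.ofReal_sin,
      show -2 * Real.pi * x * k = -(2 * Real.pi * (x * k)) by ring, Real.cos_neg, Real.sin_neg,
      smul_eq_mul]
    push_cast
    ring
  simp_rw [h1]
  rw [integral_sub (integrable_mul_cos hf k).ofReal ((integrable_mul_sin hf k).ofReal.mul_const _),
    integral_mul_const, integral_complex_ofReal, integral_complex_ofReal, hodd]
  simp [cosTransform]

theorem cosTransform_even (f : ℝ → ℝ) : Function.Even (cosTransform f) := by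
  intro k
  simp [cosTransform]

theorem cosTransform_continuous {f : ℝ → ℝ} (hf : Integrable f) : Continuous (cosTransform f) := by
  refine continuous_of_dominated (bound := fun x => ‖f x‖)
    (fun k => (integrable_mul_cos hf k).aestronglyMeasurable)
    (fun k => Eventually.of_forall fun x => ?_) hf.norm
    (Eventually.of_forall fun x => by fun_prop)
  rw [norm_mul]
  exact mul_le_of_le_one_right (norm_nonneg _) (Real.abs_cos_le_one _)

theorem abs_cosTransform_le {f : ℝ → ℝ} (hf : Integrable f) (k : ℝ) :
    |cosTransform f k| ≤ ∫ x, |f x| := by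
  refine (norm_integral_le_integral_norm _).trans
    (integral_mono (integrable_mul_cos hf k).norm hf.norm fun x => ?_)
  simp only [norm_mul]
  exact mul_le_of_le_one_right (norm_nonneg _) (Real.abs_cos_le_one _)

theorem cosTransform_cosTransform {f : ℝ → ℝ} (he : Function.Even f) (hc : Continuous f)
    (hf : Integrable f) (hf' : Integrable (cosTransform f)) :
    cosTransform (cosTransform f) = f := by
  have h1 : 𝓕 (fun x : ℝ => (f x : ℂ)) = fun k => (cosTransform f k : ℂ) :=
    funext fun k => fourier_ofReal_eq_cosTransform he hf k
  have h2 := Continuous.fourierInv_fourier_eq (f := fun x : ℝ => (f x : ℂ)) (by fun_prop)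
    hf.ofReal (by rw [h1]; exact hf'.ofReal)
  funext x
  have h3 := congrFun h2 x
  rw [Real.fourierInv_eq_fourier_neg, h1,
    fourier_ofReal_eq_cosTransform (cosTransform_even f) hf', cosTransform_even] at h3
  exact_mod_cast h3

/-- Fubini and the product-to-sum formula. Multiplying by a transform averages translates, so sign
and support can be followed one factor at a time. -/
theorem cosTransform_mul_cosTransform {P φ : ℝ → ℝ} (hP : Integrable P) (hφ : Integrable φ)
    (a x : ℝ) :
    cosTransform (fun k => P k * cosTransform φ (a * k)) x =
      ∫ y, φ y * ((cosTransform P (x - a * y) + cosTransform P (x + a * y)) / 2) := by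
  have hint : Integrable (fun z : ℝ × ℝ => (P z.1 * φ z.2) *
      (Real.cos (2 * Real.pi * (z.2 * (a * z.1))) * Real.cos (2 * Real.pi * (z.1 * x))))
      (volume.prod volume) := by
    refine (hP.mul_prod hφ).mul_bdd (c := 1) (Continuous.aestronglyMeasurable (by fun_prop))
      (Eventually.of_forall fun z => ?_)
    rw [norm_mul]
    exact mul_le_one₀ (Real.abs_cos_le_one _) (norm_nonneg _) (Real.abs_cos_le_one _)
  calc cosTransform (fun k => P k * cosTransform φ (a * k)) x
      = ∫ k, ∫ y, (P k * φ y) *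
        (Real.cos (2 * Real.pi * (y * (a * k))) * Real.cos (2 * Real.pi * (k * x))) := by
        simp only [cosTransform]
        congr 1 with k
        rw [← integral_const_mul, ← integral_mul_const]
        congr 1 with y
        ring
    _ = ∫ y, ∫ k, (P k * φ y) *
        (Real.cos (2 * Real.pi * (y * (a * k))) * Real.cos (2 * Real.pi * (k * x))) :=
        integral_integral_swap hint
    _ = _ := by
        congr 1 with y
        simp only [cosTransform]
        rw [← integral_add (integrable_mul_cos hP _) (integrable_mul_cos hP _), ← integral_div,
          ← integral_const_mul]
        congr 1 with k
        rw [show 2 * Real.pi * (k * (x - a * y)) =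
            2 * Real.pi * (k * x) - 2 * Real.pi * (y * (a * k)) by ring,
          show 2 * Real.pi * (k * (x + a * y)) =
            2 * Real.pi * (k * x) + 2 * Real.pi * (y * (a * k)) by ring,
          Real.cos_sub, Real.cos_add]
        ring

/-! ### The squared tent and its transform -/

/-- The normalised squared tent function `3/2 (1 - |x|)²` on `[-1, 1]`. -/
noncomputable def tentSq (x : ℝ) : ℝ := 3 / 2 * (max 0 (1 - |x|)) ^ 2

theorem tentSq_continuous : Continuous tentSq := by unfold tentSq; fun_prop

theorem tentSq_even : Function.Even tentSq := fun x => by simp [tentSq]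

theorem tentSq_nonneg (x : ℝ) : 0 ≤ tentSq x := by unfold tentSq; positivity

theorem tentSq_eq_zero {x : ℝ} (hx : 1 ≤ |x|) : tentSq x = 0 := by
  simp [tentSq, max_eq_left (sub_nonpos.2 hx)]

theorem tentSq_hasCompactSupport : HasCompactSupport tentSq :=
  HasCompactSupport.intro (isCompact_Icc (a := (-1 : ℝ)) (b := 1)) fun x hx => tentSq_eq_zero (by
    by_contra! h
    exact hx (mem_Icc.2 (abs_le.1 h.le)))

theorem tentSq_integrable : Integrable tentSq :=
  tentSq_continuous.integrable_of_hasCompactSupport tentSq_hasCompactSupport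

theorem cosTransform_tentSq_eq_interval (k : ℝ) :
    cosTransform tentSq k = ∫ x in (0 : ℝ)..1, 3 * (1 - x) ^ 2 * Real.cos (2 * Real.pi * k * x) := by
  have h := integral_comp_abs (f := fun x => tentSq x * Real.cos (2 * Real.pi * (x * k)))
  have h1 : ∀ x : ℝ, tentSq |x| * Real.cos (2 * Real.pi * (|x| * k)) =
      tentSq x * Real.cos (2 * Real.pi * (x * k)) := by
    intro x
    rcases abs_choice x with hx | hx <;> rw [hx]
    rw [tentSq_even x, show 2 * Real.pi * (-x * k) = -(2 * Real.pi * (x * k)) by ring, Real.cos_neg]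
  simp_rw [h1] at h
  have h2 : ∫ x in Ioi (0 : ℝ), tentSq x * Real.cos (2 * Real.pi * (x * k)) =
      ∫ x in Ioc (0 : ℝ) 1, tentSq x * Real.cos (2 * Real.pi * (x * k)) := by
    refine setIntegral_eq_of_subset_of_forall_sdiff_eq_zero measurableSet_Ioi
      Ioc_subset_Ioi_self fun x hx => ?_
    have : (1 : ℝ) < x := by
      by_contra! h
      exact hx.2 ⟨hx.1, h⟩
    rw [tentSq_eq_zero (this.le.trans (le_abs_self x)), zero_mul]
  rw [cosTransform, h, h2, intervalIntegral.integral_of_le zero_le_one, ← integral_const_mul]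
  refine setIntegral_congr_fun measurableSet_Ioc fun x hx => ?_
  simp only [tentSq]
  rw [abs_of_pos hx.1, max_eq_right (sub_nonneg.2 hx.2),
    show 2 * Real.pi * (x * k) = 2 * Real.pi * k * x by ring]
  ring

theorem integral_tent_sq_mul_cos {w : ℝ} (hw : w ≠ 0) :
    ∫ x in (0 : ℝ)..1, 3 * (1 - x) ^ 2 * Real.cos (w * x) = 6 * (w - Real.sin w) / w ^ 3 := by
  have hd : ∀ x ∈ uIcc (0 : ℝ) 1, HasDerivAt (fun x => 3 * ((1 - x) ^ 2 * Real.sin (w * x) / w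
      - 2 * (1 - x) * Real.cos (w * x) / w ^ 2 - 2 * Real.sin (w * x) / w ^ 3))
      (3 * (1 - x) ^ 2 * Real.cos (w * x)) x := by
    intro x _
    have hl : HasDerivAt (fun x : ℝ => 1 - x) (-1) x := by
      simpa using (hasDerivAt_id x).const_sub 1
    have hm : HasDerivAt (fun x : ℝ => w * x) w x := by
      simpa using (hasDerivAt_id x).const_mul w
    have h := (((((hl.pow 2).mul hm.sin).div_const w).sub
      (((hl.const_mul 2).mul hm.cos).div_const (w ^ 2))).sub
      ((hm.sin.const_mul 2).div_const (w ^ 3))).const_mul 3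
    refine h.congr_deriv ?_
    simp
    field_simp
    ring
  rw [intervalIntegral.integral_eq_sub_of_hasDerivAt hd
    (Continuous.intervalIntegrable (by fun_prop) _ _)]
  simp
  field_simp
  ring

theorem cosTransform_tentSq_eq {k : ℝ} (hk : k ≠ 0) : cosTransform tentSq k =
    6 * (2 * Real.pi * k - Real.sin (2 * Real.pi * k)) / (2 * Real.pi * k) ^ 3 := by
  rw [cosTransform_tentSq_eq_interval, integral_tent_sq_mul_cos (by positivity)]

theorem cosTransform_tentSq_zero : cosTransform tentSq 0 = 1 := by
  rw [cosTransform_tentSq_eq_interval]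
  simp
  rw [intervalIntegral.integral_comp_sub_left (fun x => x ^ 2) 1]
  norm_num

theorem integral_tentSq : ∫ x, tentSq x = 1 := by
  simpa [cosTransform] using cosTransform_tentSq_zero

theorem cosTransform_tentSq_le_one (k : ℝ) : cosTransform tentSq k ≤ 1 := by
  refine (le_abs_self _).trans ((abs_cosTransform_le tentSq_integrable k).trans_eq ?_)
  simp_rw [abs_of_nonneg (tentSq_nonneg _)]
  exact integral_tentSq

/-- The Cusa–Huygens inequality. -/
theorem three_mul_sin_le {x : ℝ} (hx : 0 ≤ x) : 3 * Real.sin x ≤ x * (2 + Real.cos x) := by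
  rcases le_total Real.pi x with h | h
  · nlinarith [Real.pi_gt_three, Real.neg_one_le_cos x, Real.sin_le_one x]
  · have hd : ∀ y : ℝ, HasDerivAt (fun x => x * (2 + Real.cos x) - 3 * Real.sin x)
        (2 - 2 * Real.cos y - y * Real.sin y) y := by
      intro y
      have := ((hasDerivAt_id y).mul ((Real.hasDerivAt_cos y).const_add 2)).sub
        ((Real.hasDerivAt_sin y).const_mul 3)
      refine this.congr_deriv ?_
      simp
      ring
    have hm : MonotoneOn (fun x => x * (2 + Real.cos x) - 3 * Real.sin x) (Icc 0 Real.pi) := by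
      refine monotoneOn_of_deriv_nonneg (convex_Icc _ _) (by fun_prop)
        (fun y _ => (hd y).differentiableAt.differentiableWithinAt) fun y hy => ?_
      rw [interior_Icc] at hy
      rw [(hd y).deriv]
      -- In half-angles the derivative is `4 sin (y/2) (sin (y/2) - (y/2) cos (y/2))`, nonnegative
      -- because `y/2 < tan (y/2)`.
      have h2 : y / 2 < Real.pi / 2 := by linarith [hy.2]
      have hcos : 0 < Real.cos (y / 2) :=
        Real.cos_pos_of_mem_Ioo ⟨by linarith [hy.1, Real.pi_pos], h2⟩
      have hsin : 0 ≤ Real.sin (y / 2) :=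
        Real.sin_nonneg_of_nonneg_of_le_pi (by linarith [hy.1]) (by linarith [hy.2, hy.1])
      have ht := Real.lt_tan (by linarith [hy.1] : 0 < y / 2) h2
      rw [Real.tan_eq_sin_div_cos, lt_div_iff₀ hcos] at ht
      have e1 : Real.cos y = 1 - 2 * Real.sin (y / 2) ^ 2 := by
        have := Real.cos_two_mul (y / 2)
        rw [mul_div_cancel₀ y two_ne_zero] at this
        rw [this, Real.cos_sq']
        ring
      have e2 : Real.sin y = 2 * Real.sin (y / 2) * Real.cos (y / 2) := by
        have := Real.sin_two_mul (y / 2)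
        rwa [mul_div_cancel₀ y two_ne_zero] at this
      rw [e1, e2]
      nlinarith
    have := hm (left_mem_Icc.2 Real.pi_pos.le) ⟨hx, h⟩ hx
    simp at this
    linarith

/-- The sign of the derivative is exactly the Cusa–Huygens inequality. -/
theorem antitoneOn_sub_sin_div_cube :
    AntitoneOn (fun w : ℝ => 6 * (w - Real.sin w) / w ^ 3) (Ioi 0) := by
  have hd : ∀ y ∈ Ioi (0 : ℝ), HasDerivAt (fun w : ℝ => 6 * (w - Real.sin w) / w ^ 3)
      (6 * (3 * Real.sin y - y * (2 + Real.cos y)) / y ^ 4) y := by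
    intro y hy
    have hy0 : y ≠ 0 := (mem_Ioi.1 hy).ne'
    have := (((hasDerivAt_id y).sub (Real.hasDerivAt_sin y)).const_mul 6).div
      (hasDerivAt_pow 3 y) (by positivity)
    refine this.congr_deriv ?_
    simp
    field_simp
    ring
  refine antitoneOn_of_deriv_nonpos (convex_Ioi 0)
    (fun y hy => (hd y hy).continuousAt.continuousWithinAt)
    (fun y hy => (hd y (interior_subset hy)).differentiableAt.differentiableWithinAt)
    fun y hy => ?_
  have hy' := interior_subset hy
  rw [(hd y hy').deriv]
  refine div_nonpos_of_nonpos_of_nonneg ?_ (by positivity)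
  linarith [three_mul_sin_le (mem_Ioi.1 hy').le]

theorem cosTransform_tentSq_antitoneOn : AntitoneOn (cosTransform tentSq) (Ici 0) := by
  intro a ha b hb hab
  rcases (mem_Ici.1 ha).eq_or_lt with h | h
  · rw [← h, cosTransform_tentSq_zero]
    exact cosTransform_tentSq_le_one b
  · have hb0 := h.trans_le hab
    rw [cosTransform_tentSq_eq h.ne', cosTransform_tentSq_eq hb0.ne']
    have hpi := Real.pi_pos
    exact antitoneOn_sub_sin_div_cube (mem_Ioi.2 (by positivity)) (mem_Ioi.2 (by positivity))
      (by gcongr)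

theorem cosTransform_tentSq_pos (k : ℝ) : 0 < cosTransform tentSq k := by
  have key : ∀ k : ℝ, 0 < k → 0 < cosTransform tentSq k := by
    intro k hk
    have hpi := Real.pi_pos
    rw [cosTransform_tentSq_eq hk.ne']
    have := Real.sin_lt (by positivity : 0 < 2 * Real.pi * k)
    have : 0 < 2 * Real.pi * k - Real.sin (2 * Real.pi * k) := by linarith
    positivity
  rcases lt_trichotomy k 0 with h | h | h
  · rw [← cosTransform_even]
    exact key _ (by linarith)
  · rw [h, cosTransform_tentSq_zero]
    exact one_pos
  · exact key k h

theorem le_cosTransform_tentSq (k : ℝ) :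
    1 - 2 * Real.pi ^ 2 * k ^ 2 ≤ cosTransform tentSq k := by
  have h : ∫ x, tentSq x * (1 - 2 * Real.pi ^ 2 * k ^ 2) ≤ cosTransform tentSq k := by
    refine integral_mono (tentSq_integrable.mul_const _) (integrable_mul_cos tentSq_integrable k)
      fun x => ?_
    rcases le_total 1 |x| with hx | hx
    · simp [tentSq_eq_zero hx]
    · refine mul_le_mul_of_nonneg_left ?_ (tentSq_nonneg x)
      refine le_trans ?_ (Real.one_sub_sq_div_two_le_cos (x := 2 * Real.pi * (x * k)))
      have : x ^ 2 ≤ 1 := (sq_le_one_iff_abs_le_one x).2 hx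
      have := mul_le_mul_of_nonneg_left this (by positivity : 0 ≤ 2 * Real.pi ^ 2 * k ^ 2)
      linarith
  rwa [integral_mul_const, integral_tentSq, one_mul] at h

/-- Only polynomial decay, so minus the logarithm grows at most logarithmically; here `w ≥ 2` gives
`sin w ≤ 1 ≤ w / 2`. -/
theorem le_cosTransform_tentSq_of_one_le {k : ℝ} (hk : 1 ≤ k) :
    (4 * Real.pi ^ 2 / 3 * k ^ 2)⁻¹ ≤ cosTransform tentSq k := by
  have hpi := Real.pi_gt_three
  have hw : 2 ≤ 2 * Real.pi * k := by nlinarith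
  rw [cosTransform_tentSq_eq (by linarith),
    show (4 * Real.pi ^ 2 / 3 * k ^ 2)⁻¹ = 3 / (2 * Real.pi * k) ^ 2 by field_simp; norm_num]
  generalize 2 * Real.pi * k = w at hw
  rw [div_le_div_iff₀ (by positivity) (by positivity)]
  have := Real.sin_le_one w
  have h3 : w / 2 ≤ w - Real.sin w := by linarith
  have := mul_le_mul_of_nonneg_left h3 (by positivity : 0 ≤ 6 * w ^ 2)
  linarith

theorem cosTransform_tentSq_le (k : ℝ) : cosTransform tentSq k ≤ 2 * (1 + k ^ 2)⁻¹ := by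
  have key : ∀ k : ℝ, 0 ≤ k → cosTransform tentSq k ≤ 2 * (1 + k ^ 2)⁻¹ := by
    intro k hk
    rw [← div_eq_mul_inv, le_div_iff₀ (by positivity)]
    rcases le_total k 1 with h | h
    · have := cosTransform_tentSq_le_one k
      have h2 : 1 + k ^ 2 ≤ 2 := by nlinarith
      have := mul_le_mul this h2 (by positivity) zero_le_one
      linarith
    · have hpi := Real.pi_gt_three
      have hw : 6 * k ≤ 2 * Real.pi * k := by nlinarith
      have hle : cosTransform tentSq k ≤ (k ^ 2)⁻¹ := by
        rw [cosTransform_tentSq_eq (by linarith)]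
        generalize 2 * Real.pi * k = w at hw
        have hw0 : 0 < w := by linarith
        have h36 : 36 * k ^ 2 ≤ w ^ 2 := by nlinarith
        rw [inv_eq_one_div, div_le_div_iff₀ (by positivity) (by positivity)]
        have := Real.neg_one_le_sin w
        have h3 : w - Real.sin w ≤ 2 * w := by linarith
        have e1 := mul_le_mul_of_nonneg_left h3 (by positivity : 0 ≤ 6 * k ^ 2)
        have e2 := mul_le_mul_of_nonneg_left h36 hw0.le
        nlinarith [mul_nonneg hw0.le (sq_nonneg k)]
      have := mul_le_mul_of_nonneg_right hle (by positivity : 0 ≤ 1 + k ^ 2)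
      have : (k ^ 2)⁻¹ * (1 + k ^ 2) ≤ 2 := by
        rw [inv_mul_le_iff₀ (by positivity)]
        nlinarith
      linarith
  rcases le_total 0 k with h | h
  · exact key k h
  · have := key (-k) (by linarith)
    rwa [cosTransform_even, neg_sq] at this

theorem cosTransform_tentSq_integrable : Integrable (cosTransform tentSq) :=
  (integrable_inv_one_add_sq.const_mul 2).mono'
    (cosTransform_continuous tentSq_integrable).aestronglyMeasurable
    (Eventually.of_forall fun k => by
      rw [Real.norm_of_nonneg (cosTransform_tentSq_pos k).le]
      exact cosTransform_tentSq_le k)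

/-! ### Riemann sums of antitone functions -/

/-- Integral comparison on unit intervals: each sample is a right endpoint for the upper bound and a
left endpoint for the lower one. Staying at `x₀ > 0` allows `H` to blow up at 0. -/
theorem AntitoneOn.summable_shift {H : ℝ → ℝ} (ha : AntitoneOn H (Ioi 0))
    (hn : ∀ t ∈ Ioi (0 : ℝ), 0 ≤ H t) (hi : IntegrableOn H (Ioi 0)) {x₀ : ℝ} (hx : 0 < x₀) :
    Summable (fun i : ℕ => H (x₀ + ↑(i + 1))) ∧
      ∑' i : ℕ, H (x₀ + ↑(i + 1)) ≤ ∫ t in Ioi 0, H t ∧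
      ∫ t in Ioi (x₀ + 1), H t ≤ ∑' i : ℕ, H (x₀ + ↑(i + 1)) := by
  have hpos : ∀ i : ℕ, 0 ≤ H (x₀ + ↑(i + 1)) := fun i => hn _ (mem_Ioi.2 (by positivity))
  have hle : ∀ n, ∑ i ∈ Finset.range n, H (x₀ + ↑(i + 1)) ≤ ∫ t in Ioi 0, H t := by
    intro n
    have hsub : Icc x₀ (x₀ + n) ⊆ Ioi 0 := fun y hy => mem_Ioi.2 (hx.trans_le hy.1)
    refine (ha.mono hsub).sum_le_integral.trans ?_
    rw [intervalIntegral.integral_of_le (by simp)]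
    exact setIntegral_mono_set hi ((ae_restrict_iff' measurableSet_Ioi).2 (Eventually.of_forall hn))
      (Eventually.of_forall (Ioc_subset_Icc_self.trans hsub))
  have hs := summable_of_sum_range_le hpos hle
  refine ⟨hs, Real.tsum_le_of_sum_range_le hpos hle, ?_⟩
  have hlim := intervalIntegral_tendsto_integral_Ioi (x₀ + 1)
    (hi.mono_set (Ioi_subset_Ioi (by linarith)))
    (tendsto_atTop_add_const_left atTop (x₀ + 1) tendsto_natCast_atTop_atTop)
  refine le_of_tendsto hlim (Eventually.of_forall fun n => ?_)
  have hsub : Icc (x₀ + 1) (x₀ + 1 + n) ⊆ Ioi 0 := fun y hy => mem_Ioi.2 (by linarith [hy.1])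
  refine (ha.mono hsub).integral_le_sum.trans ?_
  refine le_of_eq_of_le (Finset.sum_congr rfl fun i _ => ?_)
    (hs.sum_le_tsum (Finset.range n) fun i _ => hpos i)
  congr 1
  push_cast
  ring

theorem AntitoneOn.summable_shift_scaled {G : ℝ → ℝ} (ha : AntitoneOn G (Ioi 0))
    (hn : ∀ t ∈ Ioi (0 : ℝ), 0 ≤ G t) (hi : IntegrableOn G (Ioi 0)) {x₀ : ℝ} (hx : 0 < x₀)
    {r : ℝ} (hr : 0 < r) :
    Summable (fun i : ℕ => G (r⁻¹ * (x₀ + ↑(i + 1)))) ∧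
      ∑' i : ℕ, G (r⁻¹ * (x₀ + ↑(i + 1))) ≤ r * ∫ t in Ioi 0, G t ∧
      r * ∫ t in Ioi (r⁻¹ * (x₀ + 1)), G t ≤ ∑' i : ℕ, G (r⁻¹ * (x₀ + ↑(i + 1))) := by
  have hr' := inv_pos.2 hr
  have hm : ∀ t ∈ Ioi (0 : ℝ), r⁻¹ * t ∈ Ioi (0 : ℝ) := fun t ht => mul_pos hr' ht
  have h := AntitoneOn.summable_shift (H := fun t => G (r⁻¹ * t))
    (fun s hs t ht hst => ha (hm s hs) (hm t ht) (by gcongr))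
    (fun t ht => hn _ (hm t ht))
    (by rw [integrableOn_Ioi_comp_mul_left_iff _ _ hr', mul_zero]; exact hi) hx
  simp only [integral_comp_mul_left_Ioi _ _ hr', inv_inv, mul_zero, smul_eq_mul] at h
  exact h

theorem exists_integral_Ioi_ge {G : ℝ → ℝ} (hn : ∀ t ∈ Ioi (0 : ℝ), 0 ≤ G t)
    (hi : IntegrableOn G (Ioi 0)) {c : ℝ} (hc : c < ∫ t in Ioi 0, G t) :
    ∃ s₀ > 0, ∀ s, 0 ≤ s → s ≤ s₀ → c ≤ ∫ t in Ioi s, G t := by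
  have hU : ⋃ n : ℕ, Ioi (1 / ((n : ℝ) + 1)) = Ioi 0 := by
    ext x
    simp only [mem_iUnion, mem_Ioi]
    exact ⟨fun ⟨n, hn⟩ => lt_trans (by positivity) hn, fun hx => exists_nat_one_div_lt hx⟩
  have ht := tendsto_setIntegral_of_monotone (μ := volume) (f := G)
    (s := fun n : ℕ => Ioi (1 / ((n : ℝ) + 1))) (fun n => measurableSet_Ioi)
    (fun m n hmn => Ioi_subset_Ioi (by gcongr)) (by rwa [hU])
  rw [hU] at ht
  obtain ⟨n, hn'⟩ := (ht.eventually (lt_mem_nhds hc)).exists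
  refine ⟨1 / ((n : ℝ) + 1), by positivity, fun s hs hs' => hn'.le.trans ?_⟩
  refine setIntegral_mono_set (hi.mono_set (Ioi_subset_Ioi hs))
    ((ae_restrict_iff' measurableSet_Ioi).2 (Eventually.of_forall fun t ht => hn t ?_))
    (Eventually.of_forall (Ioi_subset_Ioi hs'))
  exact mem_Ioi.2 (hs.trans_lt ht)

/-! ### The logarithm of the transform and the decay profile -/

/-- Minus the logarithm of the Fourier transform of `tentSq`. -/
noncomputable def negLogTentSq (y : ℝ) : ℝ := -Real.log (cosTransform tentSq y)

theorem exp_neg_negLogTentSq (y : ℝ) : Real.exp (-negLogTentSq y) = cosTransform tentSq y := by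
  rw [negLogTentSq, neg_neg, Real.exp_log (cosTransform_tentSq_pos y)]

theorem negLogTentSq_nonneg (y : ℝ) : 0 ≤ negLogTentSq y :=
  neg_nonneg.2 (Real.log_nonpos (cosTransform_tentSq_pos y).le (cosTransform_tentSq_le_one y))

theorem negLogTentSq_even : Function.Even negLogTentSq := fun y => by
  simp only [negLogTentSq, cosTransform_even tentSq y]

theorem negLogTentSq_continuous : Continuous negLogTentSq :=
  ((cosTransform_continuous tentSq_integrable).log fun y => (cosTransform_tentSq_pos y).ne').neg

theorem negLogTentSq_monotoneOn : MonotoneOn negLogTentSq (Ici 0) := fun _ ha _ hb hab =>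
  neg_le_neg (Real.log_le_log (cosTransform_tentSq_pos _)
    (cosTransform_tentSq_antitoneOn ha hb hab))

theorem negLogTentSq_le_of_abs_le {x y : ℝ} (h : |x| ≤ y) : negLogTentSq x ≤ negLogTentSq y := by
  have : negLogTentSq |x| ≤ negLogTentSq y :=
    negLogTentSq_monotoneOn (abs_nonneg x) ((abs_nonneg x).trans h) h
  rcases abs_choice x with hx | hx
  · rwa [hx] at this
  · rwa [hx, negLogTentSq_even] at this

theorem negLogTentSq_zero : negLogTentSq 0 = 0 := by
  simp [negLogTentSq, cosTransform_tentSq_zero]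

theorem exists_negLogTentSq_le_sq :
    ∃ A : ℝ, ∀ y, 0 ≤ y → y ≤ 1 → negLogTentSq y ≤ A * y ^ 2 := by
  refine ⟨2 * Real.pi ^ 2 / cosTransform tentSq 1, fun y hy hy1 => ?_⟩
  have h0 := cosTransform_tentSq_pos y
  have h1 := cosTransform_tentSq_pos 1
  have h2 := cosTransform_tentSq_antitoneOn (mem_Ici.2 hy) (mem_Ici.2 zero_le_one) hy1
  have h3 := le_cosTransform_tentSq y
  calc negLogTentSq y ≤ (cosTransform tentSq y)⁻¹ - 1 := by
        have := Real.one_sub_inv_le_log_of_pos h0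
        rw [negLogTentSq]
        linarith
    _ = (1 - cosTransform tentSq y) / cosTransform tentSq y := by field_simp
    _ ≤ (2 * Real.pi ^ 2 * y ^ 2) / cosTransform tentSq 1 := by
        gcongr
        linarith
    _ = _ := by ring

theorem exists_negLogTentSq_le_rpow {s : ℝ} (hs : 0 < s) :
    ∃ A : ℝ, ∀ y, 1 ≤ y → negLogTentSq y ≤ A * y ^ s := by
  refine ⟨(4 * Real.pi ^ 2 / 3) ^ (s / 2) / (s / 2), fun y hy => ?_⟩
  have hy0 : 0 ≤ y := by linarith
  have hpos : 0 < 4 * Real.pi ^ 2 / 3 * y ^ 2 := by positivity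
  calc negLogTentSq y ≤ Real.log (4 * Real.pi ^ 2 / 3 * y ^ 2) := by
        have := Real.log_le_log (inv_pos.2 hpos) (le_cosTransform_tentSq_of_one_le hy)
        rw [Real.log_inv] at this
        rw [negLogTentSq]
        linarith
    _ ≤ (4 * Real.pi ^ 2 / 3 * y ^ 2) ^ (s / 2) / (s / 2) :=
        Real.log_le_rpow_div hpos.le (by positivity)
    _ = _ := by
        rw [Real.mul_rpow (by positivity) (by positivity), ← Real.rpow_natCast y 2,
          ← Real.rpow_mul hy0, show ((2 : ℕ) : ℝ) * (s / 2) = s by push_cast; ring]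
        ring

/-- The profile `u ↦ negLogTentSq (u ^ (-1/δ))`, whose Riemann sums govern the decay of the
infinite product. -/
noncomputable def decayProfile (δ u : ℝ) : ℝ := negLogTentSq (u ^ (-δ⁻¹))

theorem decayProfile_nonneg (δ u : ℝ) : 0 ≤ decayProfile δ u := negLogTentSq_nonneg _

theorem decayProfile_antitoneOn {δ : ℝ} (hδ : 0 < δ) : AntitoneOn (decayProfile δ) (Ioi 0) := by
  intro a ha b hb hab
  have ha' : 0 < a := ha
  have hb' : 0 < b := hb
  exact negLogTentSq_monotoneOn (Real.rpow_nonneg hb'.le _) (Real.rpow_nonneg ha'.le _)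
    (Real.rpow_le_rpow_of_nonpos ha' hab (by simpa using hδ.le))

theorem decayProfile_continuousOn (δ : ℝ) : ContinuousOn (decayProfile δ) (Ioi 0) :=
  negLogTentSq_continuous.comp_continuousOn
    (continuousOn_id.rpow_const fun _ hx => Or.inl (mem_Ioi.1 hx).ne')

/-- Small `u` probes the logarithmic growth of `negLogTentSq` at infinity, large `u` its quadratic
vanishing at 0. -/
theorem decayProfile_integrableOn {δ : ℝ} (hδ : 0 < δ) (hδ₁ : δ < 1) :
    IntegrableOn (decayProfile δ) (Ioi 0) := by
  rw [← Ioc_union_Ioi_eq_Ioi zero_le_one]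
  have hinv : δ * δ⁻¹ = 1 := mul_inv_cancel₀ hδ.ne'
  refine IntegrableOn.union ?_ ?_
  -- The exponent `δ / 2` becomes `u ^ (-1/2)` after substitution, which is integrable at 0.
  · obtain ⟨A, hA⟩ := exists_negLogTentSq_le_rpow (half_pos hδ)
    have hint : IntegrableOn (fun u : ℝ => A * u ^ (-(1 / 2) : ℝ)) (Ioc 0 1) := by
      refine Integrable.const_mul ?_ A
      rw [← IntegrableOn, ← intervalIntegrable_iff_integrableOn_Ioc_of_le zero_le_one]
      exact intervalIntegral.intervalIntegrable_rpow' (by norm_num)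
    refine hint.mono' (((decayProfile_continuousOn δ).mono
      Ioc_subset_Ioi_self).aestronglyMeasurable measurableSet_Ioc)
      ((ae_restrict_iff' measurableSet_Ioc).2 (Eventually.of_forall fun u hu => ?_))
    rw [Real.norm_of_nonneg (decayProfile_nonneg δ u)]
    refine (hA _ (Real.one_le_rpow_of_pos_of_le_one_of_nonpos hu.1 hu.2
      (by simpa using hδ.le))).trans_eq ?_
    rw [← Real.rpow_mul hu.1.le]
    congr 2
    linear_combination (-1 / 2) * hinv
  · obtain ⟨A, hA⟩ := exists_negLogTentSq_le_sq
    have hlt : -δ⁻¹ * 2 < -1 := by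
      have := (one_lt_inv₀ hδ).2 hδ₁
      linarith
    have hint : IntegrableOn (fun u : ℝ => A * u ^ (-δ⁻¹ * 2)) (Ioi 1) :=
      Integrable.const_mul (integrableOn_Ioi_rpow_of_lt hlt one_pos) A
    refine hint.mono' (((decayProfile_continuousOn δ).mono
      (Ioi_subset_Ioi zero_le_one)).aestronglyMeasurable measurableSet_Ioi)
      ((ae_restrict_iff' measurableSet_Ioi).2 (Eventually.of_forall fun u hu => ?_))
    have hu0 : 0 < u := one_pos.trans hu
    rw [Real.norm_of_nonneg (decayProfile_nonneg δ u)]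
    refine (hA _ (Real.rpow_nonneg hu0.le _) (Real.rpow_le_one_of_one_le_of_nonpos
      (mem_Ioi.1 hu).le (by simpa using hδ.le))).trans_eq ?_
    rw [Real.rpow_mul hu0.le, Real.rpow_two]

/-- Permits the normalisation `m = C / ∫ g`. On `(0, 2 ^ (-δ)]` the profile is at least
`negLogTentSq 2`, positive since `φ̂ 2 ≤ 2/5`. -/
theorem decayProfile_integral_pos {δ : ℝ} (hδ : 0 < δ) (hδ₁ : δ < 1) :
    0 < ∫ u in Ioi 0, decayProfile δ u := by
  have h2 : 0 < negLogTentSq 2 := by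
    refine neg_pos.2 (Real.log_neg (cosTransform_tentSq_pos 2) ?_)
    have := cosTransform_tentSq_le 2
    norm_num at this
    linarith
  set t : ℝ := 2 ^ (-δ) with ht
  have ht0 : 0 < t := Real.rpow_pos_of_pos two_pos _
  have hval : decayProfile δ t = negLogTentSq 2 := by
    rw [decayProfile, ht, ← Real.rpow_mul two_pos.le, neg_mul_neg, mul_inv_cancel₀ hδ.ne',
      Real.rpow_one]
  have hsub : Ioc 0 t ⊆ Ioi 0 := Ioc_subset_Ioi_self
  have hi := decayProfile_integrableOn hδ hδ₁
  calc 0 < t * negLogTentSq 2 := mul_pos ht0 h2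
    _ = ∫ _ in Ioc 0 t, negLogTentSq 2 := by simp [ht0.le]
    _ ≤ ∫ u in Ioc 0 t, decayProfile δ u := by
        refine setIntegral_mono_on (by simp) (hi.mono_set hsub)
          measurableSet_Ioc fun u hu => ?_
        rw [← hval]
        exact decayProfile_antitoneOn hδ hu.1 ht0 hu.2
    _ ≤ _ := setIntegral_mono_set hi (Eventually.of_forall fun u => decayProfile_nonneg δ u)
        (Eventually.of_forall hsub)

/-! ### The infinite product and its transform -/

/-- The infinite product `∏ cosTransform tentSq (a i * k)`. -/
noncomputable def tentProd (a : ℕ → ℝ) (k : ℝ) : ℝ := Real.exp (-∑' i, negLogTentSq (a i * k))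

theorem cosTransform_comp_mul {c : ℝ} (hc : 0 < c) (f : ℝ → ℝ) (x : ℝ) :
    cosTransform (fun k => f (c * k)) x = c⁻¹ * cosTransform f (x / c) := by
  have h := Measure.integral_comp_mul_left
    (fun k => f k * Real.cos (2 * Real.pi * (k * (x / c)))) c
  rw [abs_of_pos (inv_pos.2 hc), smul_eq_mul] at h
  rw [cosTransform, cosTransform, ← h]
  congr 1 with k
  congr 3
  field_simp

theorem integrable_partialProd {a : ℕ → ℝ} (ha : ∀ i, 0 < a i) (n : ℕ) :
    Integrable fun k => ∏ i ∈ Finset.range (n + 1), cosTransform tentSq (a i * k) := by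
  induction n with
  | zero => simpa using cosTransform_tentSq_integrable.comp_mul_left' (ha 0).ne'
  | succ n ih =>
    simp_rw [Finset.prod_range_succ _ (n + 1)]
    refine ih.mul_bdd (c := 1)
      ((cosTransform_continuous tentSq_integrable).comp
        (continuous_const_mul _)).aestronglyMeasurable (Eventually.of_forall fun k => ?_)
    rw [Real.norm_of_nonneg (cosTransform_tentSq_pos _).le]
    exact cosTransform_tentSq_le_one _

/-- Induction on the number of factors: each new one averages translates by at most `a (n + 1)`
against a nonnegative weight, enlarging the support by that much. -/
theorem cosTransform_partialProd {a : ℕ → ℝ} (ha : ∀ i, 0 < a i) (n : ℕ) (x : ℝ) :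
    0 ≤ cosTransform
        (fun k => ∏ i ∈ Finset.range (n + 1), cosTransform tentSq (a i * k)) x ∧
      (∑ i ∈ Finset.range (n + 1), a i ≤ |x| → cosTransform
        (fun k => ∏ i ∈ Finset.range (n + 1), cosTransform tentSq (a i * k)) x = 0) := by
  induction n generalizing x with
  | zero =>
    simp only [zero_add, Finset.range_one, Finset.prod_singleton, Finset.sum_singleton]
    rw [cosTransform_comp_mul (ha 0), cosTransform_cosTransform tentSq_even tentSq_continuous
      tentSq_integrable cosTransform_tentSq_integrable]
    refine ⟨mul_nonneg (inv_nonneg.2 (ha 0).le) (tentSq_nonneg _), fun hx => ?_⟩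
    rw [tentSq_eq_zero, mul_zero]
    rwa [abs_div, abs_of_pos (ha 0), one_le_div (ha 0)]
  | succ n ih =>
    simp_rw [Finset.prod_range_succ _ (n + 1), Finset.sum_range_succ _ (n + 1)]
    rw [cosTransform_mul_cosTransform (integrable_partialProd ha n) tentSq_integrable]
    refine ⟨integral_nonneg fun y => mul_nonneg (tentSq_nonneg y)
      (div_nonneg (add_nonneg (ih _).1 (ih _).1) two_pos.le), fun hx => ?_⟩
    refine integral_eq_zero_of_ae (Eventually.of_forall fun y => ?_)
    rcases le_total 1 |y| with hy | hy
    · simp [tentSq_eq_zero hy]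
    · have hay : |a (n + 1) * y| ≤ a (n + 1) := by
        rw [abs_mul, abs_of_pos (ha _)]
        exact mul_le_of_le_one_right (ha _).le hy
      have h1 := abs_sub_abs_le_abs_sub x (a (n + 1) * y)
      have h2 := abs_sub_abs_le_abs_sub x (-(a (n + 1) * y))
      rw [abs_neg, sub_neg_eq_add] at h2
      simp [(ih (x - a (n + 1) * y)).2 (by linarith), (ih (x + a (n + 1) * y)).2 (by linarith)]

theorem tentProd_pos (a : ℕ → ℝ) (k : ℝ) : 0 < tentProd a k := Real.exp_pos _

theorem tentProd_even (a : ℕ → ℝ) : Function.Even (tentProd a) := fun k => by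
  simp only [tentProd, mul_neg, negLogTentSq_even _]

theorem tentProd_le_one (a : ℕ → ℝ) (k : ℝ) : tentProd a k ≤ 1 :=
  Real.exp_le_one_iff.2 (neg_nonpos.2 (tsum_nonneg fun _ => negLogTentSq_nonneg _))

theorem tentProd_antitoneOn {a : ℕ → ℝ} (ha : ∀ i, 0 < a i)
    (hs : ∀ k, Summable fun i => negLogTentSq (a i * k)) :
    AntitoneOn (tentProd a) (Ici 0) := fun k hk l hl hkl =>
  Real.exp_le_exp.2 (neg_le_neg ((hs k).tsum_le_tsum (fun i => negLogTentSq_monotoneOn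
    (mul_nonneg (ha i).le hk) (mul_nonneg (ha i).le hl)
    (mul_le_mul_of_nonneg_left hkl (ha i).le)) (hs l)))

theorem tentProd_continuous {a : ℕ → ℝ} (ha : ∀ i, 0 < a i)
    (hs : ∀ k, Summable fun i => negLogTentSq (a i * k)) : Continuous (tentProd a) := by
  refine Real.continuous_exp.comp (Continuous.neg ?_)
  refine continuous_iff_continuousAt.2 fun k => ?_
  refine ContinuousOn.continuousAt (s := Icc (-(|k| + 1)) (|k| + 1)) ?_
    (Icc_mem_nhds (by linarith [neg_abs_le k]) (by linarith [le_abs_self k]))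
  refine continuousOn_tsum
    (fun i => (negLogTentSq_continuous.comp (continuous_const_mul _)).continuousOn)
    -- Monotonicity makes the terms at `|k| + 1` a summable majorant on the whole interval.
    (hs (|k| + 1)) fun i x hx => ?_
  rw [Real.norm_of_nonneg (negLogTentSq_nonneg _)]
  refine negLogTentSq_le_of_abs_le ?_
  rw [abs_mul, abs_of_pos (ha i)]
  exact mul_le_mul_of_nonneg_left (abs_le.2 hx) (ha i).le

theorem tendsto_partialProd {a : ℕ → ℝ} (hs : ∀ k, Summable fun i => negLogTentSq (a i * k))
    (k : ℝ) : Tendsto (fun n => ∏ i ∈ Finset.range (n + 1), cosTransform tentSq (a i * k)) atTop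
      (𝓝 (tentProd a k)) := by
  have h := (Real.continuous_exp.tendsto _).comp
    (((hs k).hasSum.tendsto_sum_nat.comp (tendsto_add_atTop_nat 1)).neg)
  refine h.congr fun n => ?_
  simp only [Function.comp_apply, ← Finset.sum_neg_distrib, Real.exp_sum, exp_neg_negLogTentSq]

theorem tendsto_cosTransform_partialProd {a : ℕ → ℝ} (ha : ∀ i, 0 < a i)
    (hs : ∀ k, Summable fun i => negLogTentSq (a i * k)) (x : ℝ) :
    Tendsto (fun n => cosTransform
      (fun k => ∏ i ∈ Finset.range (n + 1), cosTransform tentSq (a i * k)) x) atTop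
      (𝓝 (cosTransform (tentProd a) x)) := by
  -- All factors are at most 1, so the first one alone dominates.
  refine tendsto_integral_of_dominated_convergence (fun k => cosTransform tentSq (a 0 * k))
    (fun n => (integrable_mul_cos (integrable_partialProd ha n) x).aestronglyMeasurable)
    (cosTransform_tentSq_integrable.comp_mul_left' (ha 0).ne')
    (fun n => Eventually.of_forall fun k => ?_)
    (Eventually.of_forall fun k => (tendsto_partialProd hs k).mul_const _)
  rw [norm_mul, Real.norm_of_nonneg (Finset.prod_nonneg fun i _ => (cosTransform_tentSq_pos _).le)]
  refine (mul_le_of_le_one_right (Finset.prod_nonneg fun i _ => (cosTransform_tentSq_pos _).le)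
    (Real.abs_cos_le_one _)).trans ?_
  rw [Finset.prod_range_succ']
  exact mul_le_of_le_one_left (cosTransform_tentSq_pos _).le
    (Finset.prod_le_one (fun i _ => (cosTransform_tentSq_pos _).le)
      fun i _ => cosTransform_tentSq_le_one _)

theorem cosTransform_tentProd_nonneg {a : ℕ → ℝ} (ha : ∀ i, 0 < a i)
    (hs : ∀ k, Summable fun i => negLogTentSq (a i * k)) (x : ℝ) :
    0 ≤ cosTransform (tentProd a) x :=
  ge_of_tendsto' (tendsto_cosTransform_partialProd ha hs x)
    fun n => (cosTransform_partialProd ha n x).1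

theorem tsupport_cosTransform_tentProd_subset {a : ℕ → ℝ} (ha : ∀ i, 0 < a i)
    (hs : ∀ k, Summable fun i => negLogTentSq (a i * k)) (hsum : Summable a)
    (hle : ∑' i, a i ≤ 1) : tsupport (cosTransform (tentProd a)) ⊆ Icc (-1) 1 := by
  refine closure_minimal (fun x hx => ?_) isClosed_Icc
  by_contra hx'
  have hx1 : 1 ≤ |x| := by
    by_contra! h
    exact hx' (mem_Icc.2 (abs_le.1 h.le))
  refine hx (tendsto_nhds_unique (tendsto_cosTransform_partialProd ha hs x)
    (tendsto_const_nhds.congr fun n => ((cosTransform_partialProd ha n x).2 ?_).symm))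
  exact ((hsum.sum_le_tsum _ fun i _ => (ha i).le).trans hle).trans hx1

/-! ### Smoothness from decay -/

theorem integrable_pow_mul_exp_neg_rpow (n : ℕ) {b δ : ℝ} (hb : 0 < b) (hδ : 0 < δ) :
    Integrable fun k : ℝ => |k| ^ n * Real.exp (-b * |k| ^ δ) := by
  -- The Bochner integral of a non-integrable function is 0 by convention, so a nonzero Gamma value
  -- proves integrability.
  refine Integrable.of_integral_ne_zero ?_
  have h := integral_comp_abs (f := fun k => k ^ n * Real.exp (-b * k ^ δ))
  have h2 := integral_rpow_mul_exp_neg_mul_rpow hδ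
    (neg_one_lt_zero.trans_le n.cast_nonneg : (-1 : ℝ) < (n : ℝ)) hb
  simp only [Real.rpow_natCast] at h2
  rw [h, h2]
  have := Real.Gamma_pos_of_pos (s := ((n : ℝ) + 1) / δ) (by positivity)
  positivity

theorem contDiff_cosTransform {f : ℝ → ℝ} (he : Function.Even f)
    (hf : ∀ n : ℕ, Integrable fun k => |k| ^ n * |f k|) (hm : Continuous f) :
    ContDiff ℝ ∞ (cosTransform f) := by
  have hi : Integrable f := by
    have := hf 0
    simp only [pow_zero, one_mul] at this
    exact (integrable_norm_iff hm.aestronglyMeasurable).1 this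
  have h : ContDiff ℝ ∞ (𝓕 (fun k : ℝ => (f k : ℂ))) :=
    Real.contDiff_fourier fun n _ => by simpa using hf n
  have h2 : cosTransform f = fun x => Complex.reCLM (𝓕 (fun k : ℝ => (f k : ℂ)) x) := by
    funext x
    rw [fourier_ofReal_eq_cosTransform he hi]
    simp
  rw [h2]
  exact Complex.reCLM.contDiff.comp h

/-! ### Choice of scales and the two-sided bound -/

/-- The scales of the infinite product: `((N + 1 + i + 1) / m) ^ (-1/δ)`. -/
noncomputable def tentScale (δ m : ℝ) (N i : ℕ) : ℝ := (m⁻¹ * ((N + 1 : ℝ) + ↑(i + 1))) ^ (-δ⁻¹)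

theorem tentScale_pos {m : ℝ} (hm : 0 < m) (δ : ℝ) (N i : ℕ) : 0 < tentScale δ m N i :=
  Real.rpow_pos_of_pos (by positivity) _

/-- The scales form a tail of a convergent `p`-series, `p = 1/δ > 1`. -/
theorem exists_tentScale_tsum_le_one {δ m : ℝ} (hδ : 0 < δ) (hδ₁ : δ < 1) (hm : 0 < m) :
    ∃ N : ℕ, Summable (tentScale δ m N) ∧ ∑' i, tentScale δ m N i ≤ 1 := by
  have hlt : -δ⁻¹ < -1 := neg_lt_neg ((one_lt_inv₀ hδ).2 hδ₁)
  set f : ℕ → ℝ := fun n => (m⁻¹) ^ (-δ⁻¹) * (n : ℝ) ^ (-δ⁻¹) with hf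
  have hsum : Summable f := (Real.summable_nat_rpow.2 hlt).mul_left _
  have heq : ∀ N, tentScale δ m N = fun i => f (i + (N + 2)) := by
    intro N
    funext i
    rw [tentScale, Real.mul_rpow (by positivity) (by positivity), hf]
    push_cast
    ring_nf
  clear_value f
  have ht := (tendsto_sum_nat_add f).comp (tendsto_add_atTop_nat 2)
  obtain ⟨N, hN⟩ := (ht.eventually (gt_mem_nhds one_pos)).exists
  refine ⟨N, ?_, ?_⟩
  · rw [heq N]
    exact (summable_nat_add_iff (N + 2)).2 hsum
  · rw [heq N]
    exact hN.le

theorem negLogTentSq_tentScale_mul {δ m k : ℝ} (hδ : 0 < δ) (hm : 0 < m) (hk : 0 < k) (N i : ℕ) :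
    negLogTentSq (tentScale δ m N i * k) =
      decayProfile δ ((m * k ^ δ)⁻¹ * ((N + 1 : ℝ) + ↑(i + 1))) := by
  have hkδ := Real.rpow_pos_of_pos hk δ
  rw [decayProfile, tentScale, mul_inv, mul_right_comm,
    Real.mul_rpow (x := m⁻¹ * _) (by positivity) (by positivity), Real.inv_rpow hkδ.le,
    ← Real.rpow_mul hk.le, mul_neg, mul_inv_cancel₀ hδ.ne', Real.rpow_neg_one, inv_inv]

theorem summable_negLogTentSq_tentScale {δ m : ℝ} (hδ : 0 < δ) (hδ₁ : δ < 1) (hm : 0 < m) (N : ℕ)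
    (k : ℝ) : Summable fun i => negLogTentSq (tentScale δ m N i * k) := by
  have key : ∀ k : ℝ, 0 < k → Summable fun i => negLogTentSq (tentScale δ m N i * k) := by
    intro k hk
    simp_rw [negLogTentSq_tentScale_mul hδ hm hk]
    exact ((decayProfile_antitoneOn hδ).summable_shift_scaled
      (fun t _ => decayProfile_nonneg δ t) (decayProfile_integrableOn hδ hδ₁) (by positivity)
      (mul_pos hm (Real.rpow_pos_of_pos hk δ))).1
  rcases lt_trichotomy k 0 with h | h | h
  · have := key (-k) (by linarith)
    simpa only [mul_neg, negLogTentSq_even _] using this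
  · simp [h, negLogTentSq_zero, summable_zero]
  · exact key k h

/-- The upper Riemann bound loses nothing: `m k ^ δ ∫ g = C k ^ δ`. Hence constant 1 and no ε. -/
theorem exp_neg_le_tentProd {δ C : ℝ} (hδ : 0 < δ) (hδ₁ : δ < 1) (hC : 0 < C) (N : ℕ) {k : ℝ}
    (hk : 0 ≤ k) : Real.exp (-(C * k ^ δ)) ≤
      tentProd (tentScale δ (C / ∫ u in Ioi 0, decayProfile δ u) N) k := by
  have hI := decayProfile_integral_pos hδ hδ₁
  have hm := div_pos hC hI
  refine Real.exp_le_exp.2 (neg_le_neg ?_)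
  rcases hk.eq_or_lt with h | h
  · simp [← h, negLogTentSq_zero, hδ.ne']
  · simp_rw [negLogTentSq_tentScale_mul hδ hm h]
    refine ((decayProfile_antitoneOn hδ).summable_shift_scaled
      (fun t _ => decayProfile_nonneg δ t) (decayProfile_integrableOn hδ hδ₁) (by positivity)
      (mul_pos hm (Real.rpow_pos_of_pos h δ))).2.1.trans_eq ?_
    field_simp

theorem exists_tentProd_le {δ C : ℝ} (hδ : 0 < δ) (hδ₁ : δ < 1) (hC : 0 < C) (N : ℕ) {ε : ℝ}
    (hε : 0 < ε) : ∃ c : ℝ, 0 < c ∧ ∀ k : ℝ, 0 ≤ k →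
      tentProd (tentScale δ (C / ∫ u in Ioi 0, decayProfile δ u) N) k ≤
        c * Real.exp (-((1 - ε) * C * k ^ δ)) := by
  have hI := decayProfile_integral_pos hδ hδ₁
  have hi := decayProfile_integrableOn hδ hδ₁
  set I := ∫ u in Ioi 0, decayProfile δ u with hIdef
  have hm := div_pos hC hI
  set m := C / I with hmdef
  obtain ⟨s₀, hs₀, hs⟩ := exists_integral_Ioi_ge (fun t _ => decayProfile_nonneg δ t) hi
    (c := (1 - ε) * I) (by rw [← hIdef]; nlinarith)
  -- Once `m k ^ δ ≥ M`, the rescaled cutoff `(N + 2) / (m k ^ δ)` is at most `s₀`, so the omitted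
  -- part of the integral costs at most `ε I`.
  set M : ℝ := ((N + 1 : ℝ) + 1) / s₀ with hM
  have hM0 : 0 < M := by positivity
  refine ⟨Real.exp (C * (M / m)), Real.exp_pos _, fun k hk => ?_⟩
  have hkδ := Real.rpow_nonneg hk δ
  rw [← Real.exp_add]
  rcases le_total M (m * k ^ δ) with h | h
  · have hr : 0 < m * k ^ δ := hM0.trans_le h
    have hk0 : 0 < k := by
      refine hk.lt_of_ne fun h0 => ?_
      rw [← h0, Real.zero_rpow hδ.ne', mul_zero] at hr
      exact hr.false
    refine Real.exp_le_exp.2 ?_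
    simp_rw [negLogTentSq_tentScale_mul hδ hm hk0]
    have h1 := ((decayProfile_antitoneOn hδ).summable_shift_scaled
      (fun t _ => decayProfile_nonneg δ t) hi (by positivity : 0 < (N + 1 : ℝ)) hr).2.2
    have h2 := hs ((m * k ^ δ)⁻¹ * ((N + 1 : ℝ) + 1)) (by positivity) (by
      rw [inv_mul_le_iff₀ hr]
      rwa [hM, div_le_iff₀ hs₀] at h)
    have h3 := (mul_le_mul_of_nonneg_left h2 hr.le).trans h1
    have h4 : m * k ^ δ * ((1 - ε) * I) = (1 - ε) * C * k ^ δ := by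
      rw [hmdef]
      field_simp
    have h5 : 0 ≤ C * (M / m) := by positivity
    rw [h4] at h3
    linarith
  -- Below the threshold the trivial bound 1 suffices; the prefactor `exp (C M / m)` was chosen to
  -- absorb this range.
  · refine (tentProd_le_one _ _).trans (Real.one_le_exp ?_)
    have h1 : k ^ δ ≤ M / m := by rwa [le_div_iff₀ hm, mul_comm]
    have h2 := mul_le_mul_of_nonneg_left h1 hC.le
    have h3 : 0 ≤ ε * (C * k ^ δ) := by positivity
    linarith

/-- For `0 < δ < 1` and `C > 0` there is one smooth, real, even, nonnegative function `F` supported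
in `[-1, 1]` whose Fourier transform `k ↦ ∫ exp (-2πikx) F x dx` is real, decreasing on `[0, ∞)`,
and, for every `ε > 0`, lies between constant multiples (with constants depending on `ε`) of
`exp (-(1 + ε) C k ^ δ)` and `exp (-(1 - ε) C k ^ δ)` for all `k ≥ 0`. -/
theorem mainTheorem1 (δ C : ℝ) (hδ₀ : 0 < δ) (hδ₁ : δ < 1) (hC : 0 < C) :
    ∃ F : ℝ → ℝ,
      ContDiff ℝ ∞ F ∧
      Function.Even F ∧
      (∀ x, 0 ≤ F x) ∧
      tsupport F ⊆ Set.Icc (-1) 1 ∧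
      (∀ k : ℝ, (𝓕 (fun x : ℝ => (F x : ℂ)) k).im = 0) ∧
      AntitoneOn (fun k : ℝ => (𝓕 (fun x : ℝ => (F x : ℂ)) k).re) (Set.Ici 0) ∧
      ∀ ε : ℝ, 0 < ε →
        (∃ c : ℝ, 0 < c ∧ ∀ k : ℝ, 0 ≤ k →
          Real.exp (-((1 + ε) * C * k ^ δ)) ≤ c * (𝓕 (fun x : ℝ => (F x : ℂ)) k).re) ∧
        (∃ c : ℝ, 0 < c ∧ ∀ k : ℝ, 0 ≤ k →
          (𝓕 (fun x : ℝ => (F x : ℂ)) k).re ≤ c * Real.exp (-((1 - ε) * C * k ^ δ))) := by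
  have hI := decayProfile_integral_pos hδ₀ hδ₁
  have hm := div_pos hC hI
  obtain ⟨N, hsum, hle⟩ := exists_tentScale_tsum_le_one hδ₀ hδ₁ hm
  have hlow := fun k hk => exp_neg_le_tentProd hδ₀ hδ₁ hC N (k := k) hk
  have hup := fun ε hε => exists_tentProd_le hδ₀ hδ₁ hC N (ε := ε) hε
  have ha := tentScale_pos hm δ N
  have hs := summable_negLogTentSq_tentScale hδ₀ hδ₁ hm N
  generalize tentScale δ (C / ∫ u in Ioi 0, decayProfile δ u) N = a at *
  have hc := tentProd_continuous ha hs
  have hdecay : ∀ n : ℕ, Integrable fun k => |k| ^ n * |tentProd a k| := by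
    intro n
    -- Any fixed `ε < 1` gives stretched-exponential decay, enough for all moments.
    obtain ⟨c, hc0, hc'⟩ := hup (1 / 2) one_half_pos
    refine ((integrable_pow_mul_exp_neg_rpow n (half_pos hC) hδ₀).const_mul c).mono'
      (by fun_prop) (Eventually.of_forall fun k => ?_)
    rw [Real.norm_of_nonneg (by positivity), abs_of_pos (tentProd_pos a k)]
    have h1 : tentProd a k = tentProd a |k| := by
      rcases abs_choice k with h | h <;> rw [h]
      rw [tentProd_even]
    have h2 := hc' |k| (abs_nonneg k)
    rw [h1, show c * (|k| ^ n * Real.exp (-(C / 2) * |k| ^ δ)) =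
      |k| ^ n * (c * Real.exp (-((1 - 1 / 2) * C * |k| ^ δ))) by
        rw [show -(C / 2) * |k| ^ δ = -((1 - 1 / 2) * C * |k| ^ δ) by ring]; ring]
    exact mul_le_mul_of_nonneg_left h2 (by positivity)
  have hPi : Integrable (tentProd a) := by
    refine (integrable_norm_iff hc.aestronglyMeasurable).1 ?_
    simpa using hdecay 0
  have hsupp := tsupport_cosTransform_tentProd_subset ha hs hsum hle
  have hFi : Integrable (cosTransform (tentProd a)) :=
    (cosTransform_continuous hPi).integrable_of_hasCompactSupport
      (isCompact_Icc.of_isClosed_subset (isClosed_tsupport _) hsupp)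
  have hF : ∀ k : ℝ, 𝓕 (fun x : ℝ => (cosTransform (tentProd a) x : ℂ)) k = (tentProd a k : ℂ) := by
    intro k
    rw [fourier_ofReal_eq_cosTransform (cosTransform_even _) hFi,
      cosTransform_cosTransform (tentProd_even a) hc hPi hFi]
  refine ⟨cosTransform (tentProd a), contDiff_cosTransform (tentProd_even a) hdecay hc,
    cosTransform_even _, cosTransform_tentProd_nonneg ha hs, hsupp, ?_⟩
  simp only [hF, Complex.ofReal_im, Complex.ofReal_re, implies_true, true_and]
  -- The lower bound already holds at `ε = 0` with constant 1, and `ε > 0` only weakens it.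
  refine ⟨tentProd_antitoneOn ha hs, fun ε hε => ⟨⟨1, one_pos, fun k hk => ?_⟩, hup ε hε⟩⟩
  rw [one_mul]
  refine le_trans (Real.exp_le_exp.2 ?_) (hlow k hk)
  have : 0 ≤ ε * (C * k ^ δ) := by positivity
  linarith
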